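/- Fix $p\in[1,\infty]$. An axis-centered circle has a center $(t,0)$ with $t\in\mathbb{R}$ and a radius $r\ge 0$; it covers a point $q\in\mathbb{R}^2$ if the $L_p$ distance from $q$ to $(t,0)$ is at most $r$. The cost of a finite family of circles with radii $r_1,\dots,r_k$ is $\sum_j f(r_j)$, where $f:[0,\infty)\to\mathbb{R}$ is the cost function. The model of computation is a real RAM, i.e. a program with integer and real variables and arrays, where each of the following takes one step: memory accesses, assignments and branches; addition, (truncated) subtraction and comparison of integers; conversion of an integer to a real; the four arithmetic operations and comparison of reals; the $L_p$ norm of a vector; the $x$-coordinate of the center of the leftmost smallest axis-centered circle enclosing two given points; and the evaluation of $f$. Theorem. There are a program and a function $T:\mathbb{N}\to\mathbb{N}$ with $T(n)=O(n^4\log n)$, both independent of $f$, such that for every non-decreasing and non-negative cost function $f:[0,\infty)\to\mathbb{R}$, every $n$ and every $n$ clients in the plane, the program, started on the coordinates of the clients, halts after at most $T(n)$ steps and outputs the centers and radii of a finite family of axis-centered circles that covers all the clients and has minimum cost among all finite families of axis-centered circles covering all the clients. -/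

import Mathlib

open scoped NNReal ENNReal

namespace LineCover

noncomputable section

/-! ### Axis-centered `L_p` circles and covers -/

/-- The `L_p` distance between the point `q` of the plane and the point `(t, 0)` of the `x`-axis. -/
def axisDist (p : ℝ≥0∞) [Fact (1 ≤ p)] (q : ℝ × ℝ) (t : ℝ) : ℝ :=
  dist (WithLp.toLp p q) (WithLp.toLp p ((t, 0) : ℝ × ℝ))

/-- A circle centered at the point `(center, 0)` of the `x`-axis; radius zero is allowed. -/
structure AxisCircle where
  center : ℝ
  radius : ℝ≥0

/-- The client `q` is covered by the circle `C` in the `L_p` metric. -/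
def AxisCircle.Covers (p : ℝ≥0∞) [Fact (1 ≤ p)] (C : AxisCircle) (q : ℝ × ℝ) : Prop :=
  axisDist p q C.center ≤ C.radius

/-- The finite family `L` of circles covers every client. -/
def IsCover (p : ℝ≥0∞) [Fact (1 ≤ p)] {n : ℕ} (Y : Fin n → ℝ × ℝ) (L : List AxisCircle) : Prop :=
  ∀ i, ∃ C ∈ L, C.Covers p (Y i)

/-- The sum of the costs of the circles. -/
def cost (f : ℝ≥0 → ℝ) (L : List AxisCircle) : ℝ :=
  (L.map fun C => f C.radius).sum

/-- `L` is a cover whose cost is minimum among all finite covers by axis-centered circles. -/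
def IsMinCostCover (p : ℝ≥0∞) [Fact (1 ≤ p)] (f : ℝ≥0 → ℝ) {n : ℕ} (Y : Fin n → ℝ × ℝ)
    (L : List AxisCircle) : Prop :=
  IsCover p Y L ∧ ∀ L' : List AxisCircle, IsCover p Y L' → cost f L ≤ cost f L'

/-- The radius of the smallest circle centered at `(t, 0)` that encloses both `a` and `b`. -/
def pairRadius (p : ℝ≥0∞) [Fact (1 ≤ p)] (a b : ℝ × ℝ) (t : ℝ) : ℝ :=
  max (axisDist p a t) (axisDist p b t)

/-- The `x`-coordinate of the center of the leftmost smallest axis-centered circle that encloses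
both `a` and `b` (the circle pinned by `a` and `b`). -/
def pinCenter (p : ℝ≥0∞) [Fact (1 ≤ p)] (a b : ℝ × ℝ) : ℝ :=
  sInf {t | ∀ s, pairRadius p a b t ≤ pairRadius p a b s}

/-- The infimum in the definition of `pinCenter` is attained. -/
theorem isLeast_pinCenter (p : ℝ≥0∞) [Fact (1 ≤ p)] (a b : ℝ × ℝ) :
    IsLeast {t | ∀ s, pairRadius p a b t ≤ pairRadius p a b s} (pinCenter p a b) := by
  have hc : Continuous (pairRadius p a b) := by
    have h : Continuous fun t : ℝ => WithLp.toLp p ((t, 0) : ℝ × ℝ) :=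
      (WithLp.prod_continuous_toLp p ℝ ℝ).comp (by fun_prop)
    exact (continuous_const.dist h).max (continuous_const.dist h)
  have hb : ∀ t, |a.1 - t| ≤ pairRadius p a b t := by
    intro t
    refine le_trans ?_ (le_max_left _ _)
    rw [axisDist, dist_eq_norm]
    exact WithLp.norm_fst_le (x := WithLp.toLp p a - WithLp.toLp p ((t, 0) : ℝ × ℝ))
  have hsub : {t | ∀ s, pairRadius p a b t ≤ pairRadius p a b s} ⊆
      Metric.closedBall a.1 (pairRadius p a b 0) := by
    intro t ht
    rw [Metric.mem_closedBall, dist_comm, Real.dist_eq]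
    exact (hb t).trans (ht 0)
  have hclosed : IsClosed {t | ∀ s, pairRadius p a b t ≤ pairRadius p a b s} := by
    simp only [Set.ofPred_forall]
    exact isClosed_iInter fun s => isClosed_le hc continuous_const
  have hne : {t | ∀ s, pairRadius p a b t ≤ pairRadius p a b s}.Nonempty := by
    refine hc.exists_forall_le ?_
    refine Filter.tendsto_atTop_mono (fun t => ?_)
      (Filter.tendsto_atTop_add_const_right _ (-|a.1|) (tendsto_norm_cocompact_atTop (E := ℝ)))
    have h1 := hb t
    have h2 := abs_sub_abs_le_abs_sub t a.1
    rw [abs_sub_comm] at h2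
    rw [Real.norm_eq_abs]
    linarith
  have hbdd : BddBelow {t | ∀ s, pairRadius p a b t ≤ pairRadius p a b s} :=
    Metric.isBounded_closedBall.bddBelow.mono hsub
  exact hclosed.isLeast_csInf hne hbdd

/-! ### A real RAM with a step count

Memory consists of integer (natural number) and real variables and arrays. Integers support
addition, truncated subtraction and comparison and serve as array indices; reals support field
arithmetic and comparison (there is no rounding to integers). Unit-cost primitives on reals are
in addition the `L_p` norm of a vector, the center of the circle pinned by two points, and the
evaluation of the cost function. -/

/-- The memory of the machine. -/
structure Store where
  nvar : ℕ → ℕ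
  rvar : ℕ → ℝ
  narr : ℕ → ℕ → ℕ
  rarr : ℕ → ℕ → ℝ

/-- Integer expressions. -/
inductive NExpr where
  | lit (k : ℕ)
  | var (v : ℕ)
  | read (a : ℕ) (i : NExpr)
  | add (x y : NExpr)
  | sub (x y : NExpr)

/-- Real expressions. -/
inductive RExpr where
  | ofNat (e : NExpr)
  | var (v : ℕ)
  | read (a : ℕ) (i : NExpr)
  | add (x y : RExpr)
  | sub (x y : RExpr)
  | mul (x y : RExpr)
  | div (x y : RExpr)
  | lpNorm (x y : RExpr)
  | pin (ax ay bx bY : RExpr)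
  | costFn (r : RExpr)

/-- Tests. -/
inductive Test where
  | nle (x y : NExpr)
  | rle (x y : RExpr)
  | neg (b : Test)
  | conj (b c : Test)

/-- Programs. -/
inductive Prog where
  | skip
  | setN (v : ℕ) (e : NExpr)
  | setR (v : ℕ) (e : RExpr)
  | writeN (a : ℕ) (i : NExpr) (e : NExpr)
  | writeR (a : ℕ) (i : NExpr) (e : RExpr)
  | seq (c d : Prog)
  | ite (b : Test) (c d : Prog)
  | while (b : Test) (c : Prog)

/-- The value of an integer expression. -/
def NExpr.eval (s : Store) : NExpr → ℕ
  | .lit k => k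
  | .var v => s.nvar v
  | .read a i => s.narr a (i.eval s)
  | .add x y => x.eval s + y.eval s
  | .sub x y => x.eval s - y.eval s

/-- The value of a real expression. -/
def RExpr.eval (p : ℝ≥0∞) [Fact (1 ≤ p)] (f : ℝ≥0 → ℝ) (s : Store) : RExpr → ℝ
  | .ofNat e => (e.eval s : ℝ)
  | .var v => s.rvar v
  | .read a i => s.rarr a (i.eval s)
  | .add x y => x.eval p f s + y.eval p f s
  | .sub x y => x.eval p f s - y.eval p f s
  | .mul x y => x.eval p f s * y.eval p f s
  | .div x y => x.eval p f s / y.eval p f s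
  | .lpNorm x y => ‖WithLp.toLp p (x.eval p f s, y.eval p f s)‖
  | .pin ax ay bx bY =>
      pinCenter p (ax.eval p f s, ay.eval p f s) (bx.eval p f s, bY.eval p f s)
  | .costFn r => f (r.eval p f s).toNNReal

/-- The truth value of a test. -/
def Test.Holds (p : ℝ≥0∞) [Fact (1 ≤ p)] (f : ℝ≥0 → ℝ) (s : Store) : Test → Prop
  | .nle x y => x.eval s ≤ y.eval s
  | .rle x y => x.eval p f s ≤ y.eval p f s
  | .neg b => ¬ b.Holds p f s
  | .conj b c => b.Holds p f s ∧ c.Holds p f s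

/-- The number of steps that the evaluation of an integer expression takes: one per node. -/
def NExpr.steps : NExpr → ℕ
  | .lit _ => 1
  | .var _ => 1
  | .read _ i => i.steps + 1
  | .add x y => x.steps + y.steps + 1
  | .sub x y => x.steps + y.steps + 1

/-- The number of steps that the evaluation of a real expression takes: one per node. -/
def RExpr.steps : RExpr → ℕ
  | .ofNat e => e.steps + 1
  | .var _ => 1
  | .read _ i => i.steps + 1
  | .add x y => x.steps + y.steps + 1
  | .sub x y => x.steps + y.steps + 1
  | .mul x y => x.steps + y.steps + 1
  | .div x y => x.steps + y.steps + 1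
  | .lpNorm x y => x.steps + y.steps + 1
  | .pin ax ay bx bY => ax.steps + ay.steps + bx.steps + bY.steps + 1
  | .costFn r => r.steps + 1

/-- The number of steps that a test takes: one per node. -/
def Test.steps : Test → ℕ
  | .nle x y => x.steps + y.steps + 1
  | .rle x y => x.steps + y.steps + 1
  | .neg b => b.steps + 1
  | .conj b c => b.steps + c.steps + 1

/-- `Exec p f c s t s'`: the program `c`, started with memory `s`, halts after exactly `t` steps
with memory `s'`. -/
inductive Exec (p : ℝ≥0∞) [Fact (1 ≤ p)] (f : ℝ≥0 → ℝ) : Prog → Store → ℕ → Store → Prop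
  | skip (s : Store) : Exec p f .skip s 1 s
  | setN (v : ℕ) (e : NExpr) (s : Store) :
      Exec p f (.setN v e) s (e.steps + 1)
        { s with nvar := Function.update s.nvar v (e.eval s) }
  | setR (v : ℕ) (e : RExpr) (s : Store) :
      Exec p f (.setR v e) s (e.steps + 1)
        { s with rvar := Function.update s.rvar v (e.eval p f s) }
  | writeN (a : ℕ) (i e : NExpr) (s : Store) :
      Exec p f (.writeN a i e) s (i.steps + e.steps + 1)
        { s with narr :=
            Function.update s.narr a (Function.update (s.narr a) (i.eval s) (e.eval s)) }
  | writeR (a : ℕ) (i : NExpr) (e : RExpr) (s : Store) :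
      Exec p f (.writeR a i e) s (i.steps + e.steps + 1)
        { s with rarr :=
            Function.update s.rarr a (Function.update (s.rarr a) (i.eval s) (e.eval p f s)) }
  | seq {c d : Prog} {s₁ s₂ s₃ : Store} {t₁ t₂ : ℕ} :
      Exec p f c s₁ t₁ s₂ → Exec p f d s₂ t₂ s₃ → Exec p f (.seq c d) s₁ (t₁ + t₂) s₃
  | iteTrue {b : Test} {c d : Prog} {s s' : Store} {t : ℕ} :
      b.Holds p f s → Exec p f c s t s' → Exec p f (.ite b c d) s (b.steps + t + 1) s'
  | iteFalse {b : Test} {c d : Prog} {s s' : Store} {t : ℕ} :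
      ¬ b.Holds p f s → Exec p f d s t s' → Exec p f (.ite b c d) s (b.steps + t + 1) s'
  | whileTrue {b : Test} {c : Prog} {s₁ s₂ s₃ : Store} {t₁ t₂ : ℕ} :
      b.Holds p f s₁ → Exec p f c s₁ t₁ s₂ → Exec p f (.while b c) s₂ t₂ s₃ →
        Exec p f (.while b c) s₁ (b.steps + t₁ + t₂ + 1) s₃
  | whileFalse {b : Test} {c : Prog} {s : Store} :
      ¬ b.Holds p f s → Exec p f (.while b c) s (b.steps + 1) s

/-- The machine is deterministic: the run of a program, its final memory and its number of steps
are determined by the initial memory. -/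
theorem Exec.deterministic {p : ℝ≥0∞} [Fact (1 ≤ p)] {f : ℝ≥0 → ℝ} {c : Prog} {s s₁ s₂ : Store}
    {t₁ t₂ : ℕ} (h₁ : Exec p f c s t₁ s₁) (h₂ : Exec p f c s t₂ s₂) : t₁ = t₂ ∧ s₁ = s₂ := by
  induction h₁ generalizing t₂ s₂ with
  | skip | setN | setR | writeN | writeR => cases h₂; exact ⟨rfl, rfl⟩
  | seq _ _ ih₁ ih₂ =>
    cases h₂ with
    | seq h h' =>
      obtain ⟨rfl, rfl⟩ := ih₁ h
      obtain ⟨rfl, rfl⟩ := ih₂ h'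
      exact ⟨rfl, rfl⟩
  | iteTrue hb _ ih =>
    cases h₂ with
    | iteTrue _ h => obtain ⟨rfl, rfl⟩ := ih h; exact ⟨rfl, rfl⟩
    | iteFalse hb' _ => exact absurd hb hb'
  | iteFalse hb _ ih =>
    cases h₂ with
    | iteTrue hb' _ => exact absurd hb' hb
    | iteFalse _ h => obtain ⟨rfl, rfl⟩ := ih h; exact ⟨rfl, rfl⟩
  | whileTrue hb _ _ ih₁ ih₂ =>
    cases h₂ with
    | whileTrue _ h h' =>
      obtain ⟨rfl, rfl⟩ := ih₁ h
      obtain ⟨rfl, rfl⟩ := ih₂ h'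
      exact ⟨rfl, rfl⟩
    | whileFalse hb' => exact absurd hb hb'
  | whileFalse hb =>
    cases h₂ with
    | whileTrue hb' _ _ => exact absurd hb' hb
    | whileFalse _ => exact ⟨rfl, rfl⟩

/-- The initial memory: integer variable `0` holds the number `n` of clients, the real arrays `0`
and `1` hold their `x`- and `y`-coordinates, and everything else is zero. -/
def inputStore {n : ℕ} (Y : Fin n → ℝ × ℝ) : Store where
  nvar := fun v => if v = 0 then n else 0
  rvar := fun _ => 0
  narr := fun _ _ => 0
  rarr := fun a i =>
    if h : i < n then
      if a = 0 then (Y ⟨i, h⟩).1 else if a = 1 then (Y ⟨i, h⟩).2 else 0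
    else 0

/-- The final memory `s` describes the family `L` of circles: integer variable `1` holds their
number, and the real arrays `2` and `3` hold their centers and radii. -/
def Outputs (s : Store) (L : List AxisCircle) : Prop :=
  s.nvar 1 = L.length ∧
    ∀ (i : ℕ) (h : i < L.length), s.rarr 2 i = L[i].center ∧ s.rarr 3 i = L[i].radius

end

end LineCover

namespace LineCover

/-! ### Geometry of axis-centered circles -/

section Geometry

variable {p : ℝ≥0∞} [Fact (1 ≤ p)]

/-! Two facts about axis-centered circles reduce the problem to a dynamic program.

Finitely many candidates: the distance from a client to `(t, 0)` is convex in `t`, so the leftmost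
smallest circle enclosing a finite set is already determined by two of its points, one blocking
every move to the left and one blocking improvement to the right (`exists_pinned_circle`). As the
cost function is monotone, only the circles pinned by pairs of clients matter.

Linear structure: two circles cross at most once above the axis (`axisDist_exchange`). Hence, once
the clients are sorted by `x`-coordinate, every cover can be replaced, at no greater cost, by one
that serves consecutive runs of clients (`exists_runCover`).

The minimum cost for a prefix of length `j` is therefore the minimum, over the pairs `a`, `b` and
the starts `i < j` for which the pinned circle covers the clients from `i` to `j - 1`, of the value
at `i` plus the cost of that circle. For fixed `j`, `a`, `b` the admissible `i` are found by walking
down from `j` to the first uncovered client. Four nested loops give `O(n^4)` steps, which dominates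
the quadratic sort.

Correctness has two halves: each entry comes from an actual run, so the predecessors yield a cover
of exactly the tabulated cost (`runs_outputProg`), and no run partition is cheaper
(`Table.Filled.value_le`). -/

theorem axisDist_eq_norm (q : ℝ × ℝ) (t : ℝ) :
    axisDist p q t = ‖WithLp.toLp p (q.1 - t, q.2)‖ := by
  rw [axisDist, dist_eq_norm, ← WithLp.toLp_sub]
  congr 2
  ext <;> simp

theorem axisDist_nonneg (q : ℝ × ℝ) (t : ℝ) : 0 ≤ axisDist p q t := dist_nonneg

theorem continuous_axisDist (q : ℝ × ℝ) : Continuous (axisDist p q) := by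
  have h : Continuous fun t : ℝ => WithLp.toLp p ((t, 0) : ℝ × ℝ) :=
    (WithLp.prod_continuous_toLp p ℝ ℝ).comp (by fun_prop)
  exact continuous_const.dist h

theorem abs_sub_le_axisDist (q : ℝ × ℝ) (t : ℝ) : |q.1 - t| ≤ axisDist p q t := by
  rw [axisDist_eq_norm]
  exact WithLp.norm_fst_le (x := WithLp.toLp p (q.1 - t, q.2))

/-- The vector from `(t, 0)` to `q` is affine in `t`, and the norm is convex. -/
theorem axisDist_convex (q : ℝ × ℝ) {a b : ℝ} (ha : 0 ≤ a) (hb : 0 ≤ b) (hab : a + b = 1)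
    (s t : ℝ) : axisDist p q (a * s + b * t) ≤ a * axisDist p q s + b * axisDist p q t := by
  simp only [axisDist_eq_norm]
  have h : WithLp.toLp p (q.1 - (a * s + b * t), q.2) =
      a • WithLp.toLp p (q.1 - s, q.2) + b • WithLp.toLp p (q.1 - t, q.2) := by
    rw [← WithLp.toLp_smul, ← WithLp.toLp_smul, ← WithLp.toLp_add]
    congr 1
    ext
    · simp only [Prod.smul_mk, Prod.mk_add_mk, smul_eq_mul]; linear_combination (-q.1) * hab
    · simp only [Prod.smul_mk, Prod.mk_add_mk, smul_eq_mul]; linear_combination (-q.2) * hab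
  rw [h]
  refine (norm_add_le _ _).trans (le_of_eq ?_)
  rw [norm_smul, norm_smul, Real.norm_of_nonneg ha, Real.norm_of_nonneg hb]

/-- A point strictly between `s` and `t`, or equal to `t`, is a convex combination. -/
theorem exists_convex_weights {s t u : ℝ} (hs : s < u) (hu : u ≤ t) :
    ∃ a b : ℝ, 0 ≤ a ∧ 0 < b ∧ a + b = 1 ∧ u = a * s + b * t := by
  have h : 0 < t - s := by linarith
  refine ⟨(t - u) / (t - s), (u - s) / (t - s), div_nonneg (by linarith) h.le,
    div_pos (by linarith) h, ?_, ?_⟩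
  · field_simp; ring
  · field_simp; ring

theorem axisDist_le_of_between (q : ℝ × ℝ) {s t u R : ℝ} (hs : s ≤ u) (hu : u ≤ t)
    (h₁ : axisDist p q s ≤ R) (h₂ : axisDist p q t ≤ R) : axisDist p q u ≤ R := by
  rcases hs.eq_or_lt with rfl | hs
  · exact h₁
  obtain ⟨a, b, ha, hb, hab, rfl⟩ := exists_convex_weights hs hu
  refine (axisDist_convex q ha hb.le hab s t).trans ?_
  have hR : a * R + b * R = R := by rw [← add_mul, hab, one_mul]
  linarith [mul_le_mul_of_nonneg_left h₁ ha, mul_le_mul_of_nonneg_left h₂ hb.le]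

/-- Since `s < u`, the endpoint `t` with the strict bound has positive weight. -/
theorem axisDist_lt_of_between (q : ℝ × ℝ) {s t u R : ℝ} (hs : s < u) (hu : u ≤ t)
    (h₁ : axisDist p q s ≤ R) (h₂ : axisDist p q t < R) : axisDist p q u < R := by
  obtain ⟨a, b, ha, hb, hab, rfl⟩ := exists_convex_weights hs hu
  refine (axisDist_convex q ha hb.le hab s t).trans_lt ?_
  have hR : a * R + b * R = R := by rw [← add_mul, hab, one_mul]
  linarith [mul_le_mul_of_nonneg_left h₁ ha, mul_lt_mul_of_pos_left h₂ hb]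

/-- A continuous function on the line that dominates a distance has a least minimizer. -/
theorem exists_isLeast_minimizers {g : ℝ → ℝ} (hc : Continuous g) {x : ℝ}
    (hb : ∀ t, |x - t| ≤ g t) : ∃ t, IsLeast {t | ∀ s, g t ≤ g s} t := by
  have hsub : {t | ∀ s, g t ≤ g s} ⊆ Metric.closedBall x (g 0) := by
    intro t ht
    rw [Metric.mem_closedBall, dist_comm, Real.dist_eq]
    exact (hb t).trans (ht 0)
  have hclosed : IsClosed {t | ∀ s, g t ≤ g s} := by
    simp only [Set.ofPred_forall]
    exact isClosed_iInter fun s => isClosed_le hc continuous_const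
  have hne : {t | ∀ s, g t ≤ g s}.Nonempty := by
    refine hc.exists_forall_le ?_
    refine Filter.tendsto_atTop_mono (fun t => ?_)
      (Filter.tendsto_atTop_add_const_right _ (-|x|) (tendsto_norm_cocompact_atTop (E := ℝ)))
    have h1 := hb t
    have h2 := abs_sub_abs_le_abs_sub t x
    rw [abs_sub_comm] at h2
    rw [Real.norm_eq_abs]
    linarith
  exact ⟨_, hclosed.isLeast_csInf hne (Metric.isBounded_closedBall.bddBelow.mono hsub)⟩

/-- The radius of the circle pinned by `a` and `b`. -/
noncomputable def pinRadius (p : ℝ≥0∞) [Fact (1 ≤ p)] (a b : ℝ × ℝ) : ℝ :=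
  pairRadius p a b (pinCenter p a b)

theorem pinRadius_nonneg (a b : ℝ × ℝ) : 0 ≤ pinRadius p a b :=
  (axisDist_nonneg a _).trans (le_max_left _ _)

/-- The leftmost smallest axis-centered circle enclosing a finite set is pinned by two of its
points. -/
theorem exists_pinned_circle {ι : Type*} (S : Finset ι) (hS : S.Nonempty) (Q : ι → ℝ × ℝ)
    {t₀ r₀ : ℝ} (h₀ : ∀ i ∈ S, axisDist p (Q i) t₀ ≤ r₀) :
    ∃ a ∈ S, ∃ b ∈ S, pinRadius p (Q a) (Q b) ≤ r₀ ∧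
      ∀ i ∈ S, axisDist p (Q i) (pinCenter p (Q a) (Q b)) ≤ pinRadius p (Q a) (Q b) := by
  classical
  set g : ℝ → ℝ := fun t => S.sup' hS fun i => axisDist p (Q i) t with hg
  have hgc : Continuous g := Continuous.finset_sup'_apply hS fun i _ => continuous_axisDist (Q i)
  have hle : ∀ t, ∀ i ∈ S, axisDist p (Q i) t ≤ g t := fun t i hi =>
    Finset.le_sup' (fun i => axisDist p (Q i) t) hi
  obtain ⟨i₀, hi₀⟩ := hS
  obtain ⟨c, hcmin, hcleast⟩ := exists_isLeast_minimizers hgc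
    (fun t => (abs_sub_le_axisDist (Q i₀) t).trans (hle t i₀ hi₀))
  have hleft : ∀ t < c, g c < g t := by
    intro t ht
    refine lt_of_le_of_ne (hcmin t) fun heq => ?_
    exact absurd (hcleast (show ∀ s, g t ≤ g s from heq ▸ hcmin)) (not_le.2 ht)
  -- One point blocks the whole left side. Otherwise each point has some `u i < c` where its
  -- distance is at most `g c`; by convexity this persists up to `c`, so the largest `u i` would be
  -- a minimizer of `g` left of `c`.
  obtain ⟨a, ha, hal⟩ : ∃ a ∈ S, ∀ t < c, g c < axisDist p (Q a) t := by
    by_contra! H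
    choose! u huc hu using H
    set v := S.sup' ⟨i₀, hi₀⟩ u with hv
    have hvc : v < c := (Finset.sup'_lt_iff _).2 huc
    refine absurd (hleft v hvc) (not_lt.2 ?_)
    refine Finset.sup'_le _ _ fun i hi => ?_
    exact axisDist_le_of_between (Q i) (Finset.le_sup' u hi) hvc.le (hu i hi) (hle c i hi)
  have hac : g c ≤ axisDist p (Q a) c := by
    refine ge_of_tendsto (x := nhdsWithin c (Set.Iio c)) (f := axisDist p (Q a))
      ((continuous_axisDist (Q a)).continuousWithinAt) ?_
    filter_upwards [self_mem_nhdsWithin] with t ht using (hal t ht).le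
  -- The mirror argument on the right. The bound is weak here, because minimizers right of `c` may
  -- exist; its failure gives strict inequalities at the smallest `u i`, contradicting the
  -- minimality of `g c`.
  obtain ⟨b, hb, hbr⟩ : ∃ b ∈ S, ∀ t > c, g c ≤ pairRadius p (Q a) (Q b) t := by
    by_contra! H
    choose! u huc hu using H
    set v := S.inf' ⟨i₀, hi₀⟩ u with hv
    have hvc : c < v := (Finset.lt_inf'_iff _).2 huc
    refine absurd (hcmin v) (not_le.2 ?_)
    refine (Finset.sup'_lt_iff _).2 fun i hi => ?_
    exact axisDist_lt_of_between (Q i) hvc (Finset.inf'_le u hi) (hle c i hi)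
      ((le_max_right _ _).trans_lt (hu i hi))
  have hpc : pairRadius p (Q a) (Q b) c = g c :=
    le_antisymm (max_le (hle c a ha) (hle c b hb)) (hac.trans (le_max_left _ _))
  have hpin : pinCenter p (Q a) (Q b) = c := by
    refine (isLeast_pinCenter p (Q a) (Q b)).unique ⟨fun s => ?_, fun t ht => ?_⟩
    · rw [hpc]
      rcases lt_trichotomy s c with h | rfl | h
      · exact (hal s h).le.trans (le_max_left _ _)
      · exact hpc.ge
      · exact hbr s h
    · by_contra! h
      have h₁ := ht c
      rw [hpc] at h₁
      exact absurd ((hal t h).trans_le ((le_max_left _ _).trans h₁)) (lt_irrefl _)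
  refine ⟨a, ha, b, hb, ?_, ?_⟩
  · rw [pinRadius, hpin, hpc]
    exact (hcmin t₀).trans (Finset.sup'_le _ _ h₀)
  · rw [pinRadius, hpin, hpc]
    exact hle c

/-! ### The exchange inequality for two circles. -/

theorem abs_rpow_convex {q : ℝ} (hq : 1 ≤ q) {a b : ℝ} (ha : 0 ≤ a) (hb : 0 ≤ b)
    (hab : a + b = 1) (s t : ℝ) : |a * s + b * t| ^ q ≤ a * |s| ^ q + b * |t| ^ q := by
  have h := (convexOn_rpow hq).2 (abs_nonneg s) (abs_nonneg t) ha hb hab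
  simp only [smul_eq_mul] at h
  refine le_trans (Real.rpow_le_rpow (abs_nonneg _) ?_ (by linarith)) h
  refine (abs_add_le _ _).trans (le_of_eq ?_)
  rw [abs_mul, abs_mul, abs_of_nonneg ha, abs_of_nonneg hb]

/-- The differences `x - t` and `x' - t'` lie between `x - t'` and `x' - t` and have the same sum.
They are thus convex combinations of these with interchanged weights, and adding the two convexity
inequalities makes the weights disappear. -/
theorem abs_rpow_add_le {q : ℝ} (hq : 1 ≤ q) {x x' t t' : ℝ} (hx : x ≤ x') (ht : t ≤ t') :
    |x - t| ^ q + |x' - t'| ^ q ≤ |x - t'| ^ q + |x' - t| ^ q := by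
  rcases ht.eq_or_lt with rfl | ht
  · exact le_rfl
  obtain ⟨a, b, ha, hb, hab, h⟩ :=
    exists_convex_weights (s := x - t') (t := x' - t) (u := x - t) (by linarith) (by linarith)
  have h' : x' - t' = b * (x - t') + a * (x' - t) := by
    linear_combination -h - (x - t' + (x' - t)) * hab
  rw [h', h]
  have h₁ := abs_rpow_convex hq ha hb.le hab (x - t') (x' - t)
  have h₂ := abs_rpow_convex hq hb.le ha (by linarith) (x - t') (x' - t)
  have h₃ : (a + b) * (|x - t'| ^ q + |x' - t| ^ q) = |x - t'| ^ q + |x' - t| ^ q := by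
    rw [hab, one_mul]
  linarith

/-- The `p`-th power separates the height from the horizontal offset, so the heights cancel when the
distances to two centers are compared. -/
theorem axisDist_rpow (hp : p ≠ ∞) (q : ℝ × ℝ) (t : ℝ) :
    axisDist p q t ^ p.toReal = |q.1 - t| ^ p.toReal + |q.2| ^ p.toReal := by
  have h : 0 < p.toReal := ENNReal.toReal_pos
    (zero_lt_one.trans_le (Fact.out : 1 ≤ p)).ne' hp
  rw [axisDist_eq_norm, WithLp.prod_norm_eq_add h, ← Real.rpow_mul (by positivity),
    one_div_mul_cancel h.ne', Real.rpow_one]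
  rfl

theorem axisDist_top (q : ℝ × ℝ) (t : ℝ) : axisDist ∞ q t = max |q.1 - t| |q.2| := by
  rw [axisDist_eq_norm, WithLp.prod_norm_eq_sup]
  rfl

/-- Two circles cross at most once above the axis: right of a point that lies only in the circle
with the larger center, no point lies only in the other circle. -/
theorem axisDist_exchange {q q' : ℝ × ℝ} {t t' : ℝ} (hq : q.1 ≤ q'.1) (ht : t ≤ t')
    (h : axisDist p q t' < axisDist p q' t') : axisDist p q t ≤ axisDist p q' t := by
  by_contra! h'
  by_cases hp : p = ∞
  · subst hp
    simp only [axisDist_top] at h h'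
    rw [max_lt_iff, lt_max_iff, lt_max_iff] at h h'
    obtain ⟨h₁, h₂⟩ := h
    obtain ⟨h₃, h₄⟩ := h'
    grind
  · have hp1 : 1 ≤ p.toReal := by
      rw [← ENNReal.toReal_one]
      exact ENNReal.toReal_mono hp Fact.out
    have e₁ := Real.rpow_lt_rpow (axisDist_nonneg _ _) h (zero_lt_one.trans_le hp1)
    have e₂ := Real.rpow_lt_rpow (axisDist_nonneg _ _) h' (zero_lt_one.trans_le hp1)
    simp only [axisDist_rpow hp] at e₁ e₂
    linarith [abs_rpow_add_le hp1 hq ht]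

end Geometry

/-! ### Partitions into runs -/

/-- `L` covers the points with index less than `k` in consecutive runs, the last run by the head
of `L`. -/
inductive RunCover (p : ℝ≥0∞) [Fact (1 ≤ p)] (Q : ℕ → ℝ × ℝ) : ℕ → List AxisCircle → Prop
  | nil : RunCover p Q 0 []
  | cons {i j : ℕ} {C : AxisCircle} {L : List AxisCircle} (h : RunCover p Q i L) (hij : i < j)
      (hC : ∀ m, i ≤ m → m < j → C.Covers p (Q m)) : RunCover p Q j (C :: L)

section Runs

variable {p : ℝ≥0∞} [Fact (1 ≤ p)] {f : ℝ≥0 → ℝ} {Q : ℕ → ℝ × ℝ}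

theorem cost_cons (C : AxisCircle) (L : List AxisCircle) :
    cost f (C :: L) = f C.radius + cost f L := by
  simp [cost]

/-- Every cover of points sorted by `x`-coordinate can be replaced by a partition into runs. -/
theorem exists_runCover (hf : ∀ r, 0 ≤ f r) (N : ℕ) :
    ∀ (k : ℕ) (L : List AxisCircle), L.length = N →
      (∀ i j, i ≤ j → j < k → (Q i).1 ≤ (Q j).1) →
      (∀ i < k, ∃ C ∈ L, C.Covers p (Q i)) → ∃ L', RunCover p Q k L' ∧ cost f L' ≤ cost f L := by
  classical
  induction N with
  | zero =>
    intro k L hL _ hcov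
    obtain rfl := List.length_eq_zero_iff.1 hL
    rcases Nat.eq_zero_or_pos k with rfl | hk
    · exact ⟨[], .nil, le_rfl⟩
    · obtain ⟨C, hC, -⟩ := hcov 0 hk
      simp at hC
  | succ N ih =>
    intro k L hL hsort hcov
    have hne : L ≠ [] := by rintro rfl; simp at hL
    -- Induction on the number of circles, removing the one with the rightmost center.
    obtain ⟨C, hC, hmax⟩ : ∃ C ∈ L, ∀ D ∈ L, D.center ≤ C.center := by
      obtain ⟨C, hC, h⟩ := L.toFinset.exists_max_image AxisCircle.center
        (List.toFinset_nonempty_iff L |>.2 hne)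
      exact ⟨C, List.mem_toFinset.1 hC, fun D hD => h D (List.mem_toFinset.2 hD)⟩
    have hperm := List.perm_cons_erase hC
    have hlen : (L.erase C).length = N := by
      have := hperm.length_eq
      rw [hL, List.length_cons] at this
      omega
    have hcost : cost f L = f C.radius + cost f (L.erase C) := by
      rw [← cost_cons]
      exact (hperm.map _).sum_eq
    -- Let `i` be the first client that only `C` covers. Then `C` covers everything from `i` on: if
    -- it missed some `m` covered by `D`, the exchange property would make `D` cover `i`. The other
    -- circles handle the clients before `i`.
    by_cases hA : ∃ i, i < k ∧ ∀ D ∈ L.erase C, ¬ D.Covers p (Q i)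
    · have hi := Nat.find_spec hA
      have hmin := fun m => Nat.find_min (m := m) hA
      set i := Nat.find hA
      obtain ⟨L', hL', hcL'⟩ := ih i (L.erase C) hlen
        (fun a b hab hb => hsort a b hab (hb.trans hi.1)) (fun m hm => by
          have := hmin m hm
          push Not at this
          exact this (hm.trans hi.1))
      refine ⟨C :: L', .cons hL' hi.1 fun m him hmk => ?_, by rw [cost_cons, hcost]; linarith⟩
      have hCi : C.Covers p (Q i) := by
        obtain ⟨D, hD, hDi⟩ := hcov i hi.1
        rcases List.mem_cons.1 (hperm.mem_iff.1 hD) with rfl | hD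
        · exact hDi
        · exact absurd hDi (hi.2 D hD)
      by_contra hCm
      obtain ⟨D, hD, hDm⟩ := hcov m hmk
      rcases List.mem_cons.1 (hperm.mem_iff.1 hD) with rfl | hD'
      · exact hCm hDm
      · have := axisDist_exchange (p := p) (hsort i m him hmk) (hmax D hD)
          (lt_of_le_of_lt hCi (not_le.1 hCm))
        exact hi.2 D hD' (this.trans hDm)
    -- Here `C` is redundant, and dropping it cannot raise the cost because `f` is non-negative.
    · push Not at hA
      obtain ⟨L', hL', hc⟩ := ih k (L.erase C) hlen hsort hA
      exact ⟨L', hL', by linarith [hf C.radius]⟩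

end Runs

/-! ### Total correctness with a time bound -/

/-- Set integer variable `v` to `k`. -/
def Store.setNat (s : Store) (v k : ℕ) : Store := { s with nvar := Function.update s.nvar v k }

/-- Set real variable `v` to `x`. -/
def Store.setReal (s : Store) (v : ℕ) (x : ℝ) : Store :=
  { s with rvar := Function.update s.rvar v x }

section Logic

variable {p : ℝ≥0∞} [Fact (1 ≤ p)] {f : ℝ≥0 → ℝ}

/-- Started on `s`, the program `c` halts after at most `T` steps with a memory satisfying `P`. -/
def Runs (p : ℝ≥0∞) [Fact (1 ≤ p)] (f : ℝ≥0 → ℝ) (c : Prog) (s : Store) (T : ℕ)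
    (P : Store → Prop) : Prop :=
  ∃ t s', Exec p f c s t s' ∧ t ≤ T ∧ P s'

variable {b : Test} {c d : Prog} {s s₁ : Store} {T T₁ T₂ B K : ℕ} {P R : Store → Prop}

theorem Runs.mono (h : Runs p f c s T₁ P) (hT : T₁ ≤ T) (hP : ∀ s, P s → R s) :
    Runs p f c s T R := by
  obtain ⟨t, s', he, ht, hs⟩ := h
  exact ⟨t, s', he, ht.trans hT, hP _ hs⟩

theorem Runs.seq (h₁ : Runs p f c s T₁ P) (h₂ : ∀ s', P s' → Runs p f d s' T₂ R) :
    Runs p f (.seq c d) s (T₁ + T₂) R := by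
  obtain ⟨t, s', he, ht, hs⟩ := h₁
  obtain ⟨t', s'', he', ht', hs'⟩ := h₂ s' hs
  exact ⟨_, _, .seq he he', add_le_add ht ht', hs'⟩

/-- For straight-line code the postcondition `Eq s₁` lets unification compute the intermediate
memory. -/
theorem Runs.seq_eq (h₁ : Runs p f c s T₁ (Eq s₁)) (h₂ : Runs p f d s₁ T₂ R) :
    Runs p f (.seq c d) s (T₁ + T₂) R :=
  h₁.seq fun _ h => h ▸ h₂

theorem Runs.of_eq (h : Runs p f c s T (Eq s₁)) (hP : P s₁) : Runs p f c s T P :=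
  h.mono le_rfl fun _ h => h ▸ hP

theorem Runs.skip : Runs p f .skip s 1 (Eq s) := ⟨_, _, .skip s, le_rfl, rfl⟩

theorem Runs.setN {v k : ℕ} {e : NExpr} (h : e.eval s = k) :
    Runs p f (.setN v e) s (e.steps + 1) (Eq (s.setNat v k)) :=
  ⟨_, _, .setN v e s, le_rfl, by rw [Store.setNat, h]⟩

theorem Runs.setR {v : ℕ} {e : RExpr} {x : ℝ} (h : e.eval p f s = x) :
    Runs p f (.setR v e) s (e.steps + 1) (Eq (s.setReal v x)) :=
  ⟨_, _, .setR v e s, le_rfl, by rw [Store.setReal, h]⟩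

theorem Runs.writeN {a : ℕ} {i e : NExpr} : Runs p f (.writeN a i e) s (i.steps + e.steps + 1)
    (Eq { s with narr :=
      Function.update s.narr a (Function.update (s.narr a) (i.eval s) (e.eval s)) }) :=
  ⟨_, _, .writeN a i e s, le_rfl, rfl⟩

theorem Runs.writeR {a : ℕ} {i : NExpr} {e : RExpr} :
    Runs p f (.writeR a i e) s (i.steps + e.steps + 1)
    (Eq { s with rarr :=
      Function.update s.rarr a (Function.update (s.rarr a) (i.eval s) (e.eval p f s)) }) :=
  ⟨_, _, .writeR a i e s, le_rfl, rfl⟩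

theorem Runs.ite (h₁ : b.Holds p f s → Runs p f c s T P) (h₂ : ¬ b.Holds p f s → Runs p f d s T P) :
    Runs p f (.ite b c d) s (b.steps + T + 1) P := by
  by_cases hb : b.Holds p f s
  · obtain ⟨t, s', he, ht, hs⟩ := h₁ hb
    exact ⟨_, _, .iteTrue hb he, by omega, hs⟩
  · obtain ⟨t, s', he, ht, hs⟩ := h₂ hb
    exact ⟨_, _, .iteFalse hb he, by omega, hs⟩

/-- A loop whose body decreases the counter `m` of the invariant `I m`. -/
theorem Runs.while {I : ℕ → Store → Prop} (hK : B + b.steps + 1 ≤ K)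
    (h : ∀ m s, I m s → (¬ b.Holds p f s ∧ P s) ∨
      (b.Holds p f s ∧ ∃ m' < m, Runs p f c s B (I m'))) :
    ∀ m s, I m s → Runs p f (.while b c) s ((m + 1) * K) P := by
  intro m
  induction m using Nat.strong_induction_on with
  | _ m ih =>
    intro s hs
    rcases h m s hs with ⟨hb, hP⟩ | ⟨hb, m', hm', t, s', he, ht, hs'⟩
    · exact ⟨_, _, .whileFalse hb, by nlinarith, hP⟩
    · obtain ⟨t', s'', he', ht', hs''⟩ := ih m' hm' s' hs'
      refine ⟨_, _, .whileTrue hb he he', ?_, hs''⟩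
      -- The remaining run uses at most `m * K`, which leaves one `K` for this iteration; the extra
      -- `1` in the bound pays for the final failing test.
      have : (m' + 1) * K ≤ m * K := Nat.mul_le_mul_right K hm'
      rw [add_mul, one_mul]
      omega

/-- The loop that runs while integer variable `v` is less than integer variable `0`. -/
abbrev forLoop (v : ℕ) (c : Prog) : Prog := .while (.nle (.add (.var v) (.lit 1)) (.var 0)) c

/-- Increment of an integer variable. -/
abbrev incr (v : ℕ) : Prog := .setN v (.add (.var v) (.lit 1))

theorem Runs.incr {v k : ℕ} (h : s.nvar v = k) :
    Runs p f (incr v) s 4 (Eq (s.setNat v (k + 1))) :=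
  Runs.setN (by simp only [NExpr.eval, h])

theorem Runs.forLoop {I : ℕ → Store → Prop} {v n : ℕ} (hK : B + 6 ≤ K)
    (hI : ∀ k s, I k s → s.nvar v = k ∧ s.nvar 0 = n ∧ k ≤ n)
    (h : ∀ k s, k < n → I k s → Runs p f c s B (I (k + 1))) {k : ℕ} (hs : I k s) :
    Runs p f (forLoop v c) s ((n + 1) * K) (I n) := by
  -- The decreasing counter is the number `m = n - k` of iterations left.
  refine (Runs.while (I := fun m s => m ≤ n ∧ I (n - m) s) (P := I n) (B := B) (K := K)
      (b := .nle (.add (.var v) (.lit 1)) (.var 0)) hK ?_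
    (n - k) s ⟨by omega, ?_⟩).mono (Nat.mul_le_mul_right K (by omega)) fun _ h => h
  · rintro m s ⟨hm, hIs⟩
    obtain ⟨hv, h0, -⟩ := hI _ _ hIs
    simp only [Test.Holds, NExpr.eval, hv, h0]
    rcases Nat.eq_zero_or_pos m with rfl | hm0
    · exact Or.inl ⟨by omega, hIs⟩
    · refine Or.inr ⟨by omega, m - 1, by omega, (h _ s (by omega) hIs).mono le_rfl fun s hs => ?_⟩
      rw [show n - m + 1 = n - (m - 1) by omega] at hs
      exact ⟨by omega, hs⟩
  · rw [show n - (n - k) = k by have := (hI _ _ hs).2.2; omega]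
    exact hs

end Logic

/-! ### The program

Integer variable `0` holds the number of clients and `1` the number of circles in the output; the
variables from `2` on are loop counters. The real arrays `0` and `1` hold the clients, `2` and `3`
the output. For a prefix of `j` clients, the real arrays `4`, `5`, `6` hold the minimum cost of a
cover and the center and radius of its last circle, and the integer array `0` holds one more than
the number of clients before the last run (zero if no cover is known). -/

/-- Exchange the clients whose indices are held by the integer variables `2` and `3`. -/
def swapProg : Prog :=
  .seq (.setR 0 (.read 0 (.var 2))) <|
  .seq (.writeR 0 (.var 2) (.read 0 (.var 3))) <|
  .seq (.writeR 0 (.var 3) (.var 0)) <|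
  .seq (.setR 0 (.read 1 (.var 2))) <|
  .seq (.writeR 1 (.var 2) (.read 1 (.var 3))) <|
  .writeR 1 (.var 3) (.var 0)

/-- Sort the clients by `x`-coordinate. -/
def sortProg : Prog :=
  forLoop 2 <|
    .seq (.setN 3 (.add (.var 2) (.lit 1))) <|
    .seq (forLoop 3 <|
      .seq (.ite (.neg (.rle (.read 0 (.var 2)) (.read 0 (.var 3)))) swapProg .skip) <|
      incr 3) <|
    incr 2

/-- The distance between the client with index `i` and the point `(t, 0)`. -/
abbrev distExpr (i : NExpr) (t : RExpr) : RExpr := .lpNorm (.sub (.read 0 i) t) (.read 1 i)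

/-- Compute center, radius and cost of the circle pinned by two clients. -/
def pinProg : Prog :=
  .seq (.setR 0 (.pin (.read 0 (.var 3)) (.read 1 (.var 3)) (.read 0 (.var 4)) (.read 1 (.var 4))))
    <|
  .seq (.setR 1 (distExpr (.var 3) (.var 0))) <|
  .seq (.setR 2 (distExpr (.var 4) (.var 0))) <|
  .seq (.ite (.rle (.var 1) (.var 2)) (.setR 1 (.var 2)) .skip) <|
  .seq (.setR 2 (.costFn (.var 1))) <|
  .setN 5 (.add (.var 2) (.lit 1))

/-- Overwrite the entry of the current prefix. -/
def recordProg : Prog :=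
  .seq (.writeR 4 (.add (.var 2) (.lit 1)) (.add (.read 4 (.var 5)) (.var 2))) <|
  .seq (.writeR 5 (.add (.var 2) (.lit 1)) (.var 0)) <|
  .seq (.writeR 6 (.add (.var 2) (.lit 1)) (.var 1)) <|
  .writeN 0 (.add (.var 2) (.lit 1)) (.add (.var 5) (.lit 1))

/-- Extend the run of the current circle by one client to the left and improve the entry of the
current prefix. -/
def relaxProg : Prog :=
  .seq (.setN 5 (.sub (.var 5) (.lit 1))) <|
  .ite (.neg (.conj (.nle (.lit 1) (.read 0 (.add (.var 2) (.lit 1))))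
      (.rle (.read 4 (.add (.var 2) (.lit 1))) (.add (.read 4 (.var 5)) (.var 2)))))
    recordProg .skip

/-- Try all runs of the circle pinned by two clients. -/
def runLoop : Prog :=
  .while (.conj (.nle (.lit 1) (.var 5))
    (.rle (distExpr (.sub (.var 5) (.lit 1)) (.var 0)) (.var 1))) relaxProg

/-- Fill the table. -/
def tableProg : Prog :=
  .seq (.setN 2 (.lit 0)) <|
  forLoop 2 <|
    .seq (.setN 3 (.lit 0)) <|
    .seq (forLoop 3 <|
      .seq (.setN 4 (.lit 0)) <|
      .seq (forLoop 4 <| .seq pinProg <| .seq runLoop <| incr 4) <|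
      incr 3) <|
    incr 2

/-- Read the optimal cover off the table. -/
def outputProg : Prog :=
  .while (.nle (.lit 1) (.var 2)) <|
    .seq (.writeR 2 (.var 1) (.read 5 (.var 2))) <|
    .seq (.writeR 3 (.var 1) (.read 6 (.var 2))) <|
    .seq (incr 1) <|
    .setN 2 (.sub (.read 0 (.var 2)) (.lit 1))

/-- The whole algorithm. -/
def coverProg : Prog := .seq sortProg <| .seq tableProg outputProg

/-! ### Sorting -/

section Sorting

variable {p : ℝ≥0∞} [Fact (1 ≤ p)] {f : ℝ≥0 → ℝ} {n : ℕ}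

/-- The client with index `i`. -/
def Store.client (s : Store) (i : ℕ) : ℝ × ℝ := (s.rarr 0 i, s.rarr 1 i)

theorem runs_swapProg (s : Store) : Runs p f swapProg s 22 fun s' =>
    s'.client = s.client ∘ Equiv.swap (s.nvar 2) (s.nvar 3) ∧ s'.nvar = s.nvar ∧
      s'.narr = s.narr ∧ s'.rarr 4 = s.rarr 4 := by
  refine (Runs.seq_eq (.setR rfl) <| .seq_eq .writeR <| .seq_eq .writeR <| .seq_eq (.setR rfl) <|
    .seq_eq .writeR .writeR).mono (by decide) ?_
  rintro _ rfl
  refine ⟨?_, rfl, rfl, by simp [Store.setReal]⟩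
  funext m
  simp only [Store.client, Store.setReal, RExpr.eval, NExpr.eval, Function.comp_apply,
    Equiv.swap_apply_def, Function.update_apply]
  grind

/-- The clients in memory are those in the set `Z`, and the table is empty. -/
structure Prepared (n : ℕ) (Z : Set (ℝ × ℝ)) (s : Store) : Prop where
  nvar_zero : s.nvar 0 = n
  nvar_one : s.nvar 1 = 0
  narr_zero : ∀ j, s.narr 0 j = 0
  rarr_four : s.rarr 4 0 = 0
  clients : s.client '' Set.Iio n = Z

theorem image_comp_swap {α : Type*} (g : ℕ → α) {i j n : ℕ} (hi : i < n) (hj : j < n) :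
    g ∘ Equiv.swap i j '' Set.Iio n = g '' Set.Iio n := by
  rw [Set.image_comp]
  congr 1
  ext m
  rw [Equiv.image_eq_preimage_symm, Equiv.symm_swap]
  simp only [Set.mem_preimage, Set.mem_Iio, Equiv.swap_apply_def]
  grind

variable {Z : Set (ℝ × ℝ)} {s : Store}

theorem Prepared.setNat (h : Prepared n Z s) {v k : ℕ} (h0 : 0 ≠ v) (h1 : 1 ≠ v) :
    Prepared n Z (s.setNat v k) :=
  ⟨(Function.update_of_ne h0 ..).trans h.nvar_zero, (Function.update_of_ne h1 ..).trans h.nvar_one,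
    h.narr_zero, h.rarr_four, h.clients⟩

theorem runs_sortProg (hs : Prepared n Z s) (h2 : s.nvar 2 = 0) :
    Runs p f sortProg s ((n + 1) * ((n + 1) * 120)) fun s' => Prepared n Z s' ∧
      ∀ i j, i ≤ j → j < n → (s'.client i).1 ≤ (s'.client j).1 := by
  -- Selection sort by exchanges: in `I` the first `k` positions are final, and in `I'` position `k`
  -- moreover holds a minimum of the positions from `k` to `l - 1`.
  let I : ℕ → Store → Prop := fun k s => Prepared n Z s ∧ s.nvar 2 = k ∧ k ≤ n ∧
    ∀ i < k, ∀ j, i ≤ j → j < n → (s.client i).1 ≤ (s.client j).1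
  let I' : ℕ → ℕ → Store → Prop := fun k l s => I k s ∧ k < n ∧ s.nvar 3 = l ∧ k < l ∧ l ≤ n ∧
    ∀ j, k ≤ j → j < l → (s.client k).1 ≤ (s.client j).1
  refine (Runs.forLoop (I := I) (B := (n + 1) * 60 + 10) (K := (n + 1) * 120) (by omega)
    (fun k s h => ⟨h.2.1, h.1.nvar_zero, h.2.2.1⟩) (fun k s hk h => ?_)
    ⟨hs, h2, Nat.zero_le _, by simp⟩).mono le_rfl
    fun s' h => ⟨h.1, fun i j hij hj => h.2.2.2 i (by omega) j hij hj⟩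
  have hstart : I' k (k + 1) (s.setNat 3 (k + 1)) := by
    refine ⟨⟨h.1.setNat (by decide) (by decide), h.2⟩, hk, rfl, by omega, hk, fun j h₁ h₂ => ?_⟩
    rw [show j = k by omega]
  refine (Runs.seq_eq (.setN (by simp only [NExpr.eval, h.2.1])) <|
    Runs.seq (Runs.forLoop (I := I' k) (B := 45) (K := 60) (by omega)
      (fun l s h => ⟨h.2.2.1, h.1.1.nvar_zero, h.2.2.2.2.1⟩) (fun l s hl h => ?_) hstart)
    fun s' h => Runs.of_eq (.incr h.1.2.1) ?_).mono (P := I (k + 1)) ?_ fun _ h => h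
  · refine (Runs.seq (P := fun s => I' k l s ∧ (s.client k).1 ≤ (s.client l).1)
      (T₁ := 29) (T₂ := 4) (Runs.ite (T := 22) (fun hb => ?_) fun hb => ?_) fun s' h' => ?_).mono
        (by decide) fun _ h => h
    · obtain ⟨⟨hp, h2, hkn, hsort⟩, hk, h3, hkl, hln, hmin⟩ := h
      simp only [Test.Holds, RExpr.eval, NExpr.eval, h2, h3, not_le] at hb
      refine (runs_swapProg s).mono le_rfl ?_
      rintro s' ⟨hc, hv, ha, h4⟩
      rw [h2, h3] at hc
      have hc' : ∀ m, s'.client m = s.client (Equiv.swap k l m) := fun m => congrFun hc m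
      have hlt : (s.client l).1 < (s.client k).1 := hb
      refine ⟨⟨⟨⟨hv ▸ hp.nvar_zero, hv ▸ hp.nvar_one, ha ▸ hp.narr_zero, h4 ▸ hp.rarr_four, ?_⟩,
        hv ▸ h2, hkn, fun i hi j hij hj => ?_⟩, hk, hv ▸ h3, hkl, hln, fun j h₁ h₂ => ?_⟩, ?_⟩
      · rw [hc, image_comp_swap _ hk hl, hp.clients]
      · rw [hc', hc', Equiv.swap_apply_of_ne_of_ne hi.ne (by omega)]
        refine hsort i hi _ ?_ ?_ <;> rw [Equiv.swap_apply_def] <;> split_ifs <;> omega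
      · rw [hc', hc', Equiv.swap_apply_left, Equiv.swap_apply_def, if_neg h₂.ne]
        split_ifs
        · exact le_rfl
        · exact hlt.le.trans (hmin j h₁ h₂)
      · rw [hc', hc', Equiv.swap_apply_left, Equiv.swap_apply_right]
        exact hlt.le
    · refine (Runs.of_eq .skip ⟨h, ?_⟩).mono (by decide) fun _ h => h
      simp only [Test.Holds, RExpr.eval, NExpr.eval, h.1.2.1, h.2.2.1, not_not] at hb
      exact hb
    · obtain ⟨⟨⟨hp, h⟩, hk, h3, hkl, hln, hmin⟩, hle⟩ := h'
      refine Runs.of_eq (.incr h3) ⟨⟨hp.setNat (by decide) (by decide), h⟩, hk, rfl, by omega, hl,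
        fun j h₁ h₂ => ?_⟩
      rcases (Nat.lt_succ_iff.1 h₂).eq_or_lt with rfl | h₂
      · exact hle
      · exact hmin j h₁ h₂
  · obtain ⟨⟨hp, h2, hkn, hsort⟩, hk, h3, -, -, hmin⟩ := h
    refine ⟨hp.setNat (by decide) (by decide), rfl, hk, fun i hi j hij hj => ?_⟩
    rcases (Nat.lt_succ_iff.1 hi).eq_or_lt with rfl | hi
    · exact hmin j hij hj
    · exact hsort i hi j hij hj
  · simp only [NExpr.steps]
    omega

end Sorting
/-! ### The table -/

/-- The entries of the table: cost, center and radius of the last circle, and one more than the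
number of clients before the last run. -/
structure Table where
  value : ℕ → ℝ
  center : ℕ → ℝ
  radius : ℕ → ℝ
  pred : ℕ → ℕ

/-- The table in memory. -/
def Store.table (s : Store) : Table := ⟨s.rarr 4, s.rarr 5, s.rarr 6, s.narr 0⟩

section Table

variable (p : ℝ≥0∞) [Fact (1 ≤ p)] (f : ℝ≥0 → ℝ) (Q : ℕ → ℝ × ℝ)

/-- The circle with center `c` and radius `r` covers the points with indices from `i` to `j - 1`. -/
def CoversRun (c r : ℝ) (i j : ℕ) : Prop := ∀ m, i ≤ m → m < j → axisDist p (Q m) c ≤ r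

/-- The entry `j` describes a run ending before `j` and has the right value. -/
def Table.Valid (τ : Table) (j : ℕ) : Prop :=
  ∃ i < j, τ.pred j = i + 1 ∧ 0 ≤ τ.radius j ∧
    τ.value j = τ.value i + f (τ.radius j).toNNReal ∧
    CoversRun p Q (τ.center j) (τ.radius j) i j

/-- The entry `j` is no worse than any run from `i` to `j` by the circle pinned by `a` and `b` with
`S a b i`. -/
def Table.Beats (τ : Table) (j : ℕ) (S : ℕ → ℕ → ℕ → Prop) : Prop :=
  ∀ a b i, S a b i → i < j →
    CoversRun p Q (pinCenter p (Q a) (Q b)) (pinRadius p (Q a) (Q b)) i j →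
    τ.pred j ≠ 0 ∧ τ.value j ≤ τ.value i + f (pinRadius p (Q a) (Q b)).toNNReal

/-- The entries up to `J` are correct. -/
def Table.Filled (n J : ℕ) (τ : Table) : Prop :=
  τ.value 0 = 0 ∧ ∀ j, 0 < j → j ≤ J →
    τ.Valid p f Q j ∧ τ.Beats p f Q j fun a b _ => a < n ∧ b < n

/-- Overwrite the entry `j`. -/
def Table.set (τ : Table) (j : ℕ) (v c r : ℝ) (i : ℕ) : Table where
  value := Function.update τ.value j v
  center := Function.update τ.center j c
  radius := Function.update τ.radius j r
  pred := Function.update τ.pred j i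

variable {p f Q} {τ τ' : Table} {n J : ℕ} {S S' : ℕ → ℕ → ℕ → Prop}

/-- The tables agree on the entries up to `J`. -/
def Table.Agree (τ τ' : Table) (J : ℕ) : Prop :=
  ∀ j ≤ J, τ'.value j = τ.value j ∧ τ'.center j = τ.center j ∧ τ'.radius j = τ.radius j ∧
    τ'.pred j = τ.pred j

theorem Table.agree_set (τ : Table) {j : ℕ} (h : J < j) (v c r : ℝ) (i : ℕ) :
    τ.Agree (τ.set j v c r i) J := fun k hk => by
  have hkj : k ≠ j := by omega
  simp [Table.set, hkj]

/-- The conditions on an entry refer only to entries of no larger index, so work on entry `J + 1`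
leaves them intact. -/
theorem Table.Filled.agree (h : τ.Filled p f Q n J) (ha : τ.Agree τ' J) :
    τ'.Filled p f Q n J := by
  refine ⟨(ha 0 (Nat.zero_le _)).1.trans h.1, fun j hj hjJ => ?_⟩
  obtain ⟨⟨i, hij, hp, hr, hv, hc⟩, hb⟩ := h.2 j hj hjJ
  obtain ⟨e₁, e₂, e₃, e₄⟩ := ha j hjJ
  refine ⟨⟨i, hij, by rw [e₄, hp], by rwa [e₃], ?_, by rwa [e₂, e₃]⟩, fun a b i hS hi hcov => ?_⟩
  · rw [e₁, e₃, (ha i (by omega)).1, hv]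
  · rw [e₄, e₁, (ha i (by omega)).1]
    exact hb a b i hS hi hcov

/-- The inclusion is required only for runs that the circle really covers; this is what allows the
walk to stop at the first uncovered client. -/
theorem Table.Beats.mono (h : τ.Beats p f Q J S)
    (hS : ∀ a b i, S' a b i → i < J →
      CoversRun p Q (pinCenter p (Q a) (Q b)) (pinRadius p (Q a) (Q b)) i J → S a b i) :
    τ.Beats p f Q J S' := fun a b i hS' hi hc => h a b i (hS a b i hS' hi hc) hi hc

/-- The entry `j` is unset or valid. -/
def Table.Partial (p : ℝ≥0∞) [Fact (1 ≤ p)] (f : ℝ≥0 → ℝ) (Q : ℕ → ℝ × ℝ) (τ : Table) (j : ℕ) :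
    Prop := τ.pred j = 0 ∨ τ.Valid p f Q j

theorem Table.Beats.insert {j a b i : ℕ} (h : τ.Beats p f Q j S) (h₁ : τ.pred j ≠ 0)
    (h₂ : τ.value j ≤ τ.value i + f (pinRadius p (Q a) (Q b)).toNNReal) :
    τ.Beats p f Q j fun a' b' i' => S a' b' i' ∨ (a' = a ∧ b' = b ∧ i' = i) := by
  rintro a' b' i' (hS | ⟨rfl, rfl, rfl⟩) hi hc
  · exact h a' b' i' hS hi hc
  · exact ⟨h₁, h₂⟩

theorem Table.valid_set {j a b i : ℕ} (hi : i < j)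
    (hc : CoversRun p Q (pinCenter p (Q a) (Q b)) (pinRadius p (Q a) (Q b)) i j) :
    (τ.set j (τ.value i + f (pinRadius p (Q a) (Q b)).toNNReal) (pinCenter p (Q a) (Q b))
      (pinRadius p (Q a) (Q b)) (i + 1)).Valid p f Q j :=
  ⟨i, hi, by simp [set], by simpa [set] using pinRadius_nonneg _ _, by simp [set, hi.ne],
    by simpa [set] using hc⟩

theorem Table.Beats.set {j a b i : ℕ} (h : τ.Beats p f Q j S) (hi : i < j)
    (hlt : τ.pred j = 0 ∨ τ.value i + f (pinRadius p (Q a) (Q b)).toNNReal < τ.value j) :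
    (τ.set j (τ.value i + f (pinRadius p (Q a) (Q b)).toNNReal) (pinCenter p (Q a) (Q b))
      (pinRadius p (Q a) (Q b)) (i + 1)).Beats p f Q j
      fun a' b' i' => S a' b' i' ∨ (a' = a ∧ b' = b ∧ i' = i) := by
  refine Table.Beats.insert (fun a' b' i' hS hi' hc => ?_) (by simp [Table.set])
    (by simp [Table.set, hi.ne])
  obtain ⟨h₁, h₂⟩ := h a' b' i' hS hi' hc
  refine ⟨by simp [Table.set], ?_⟩
  simp only [Table.set, Function.update_self, Function.update_of_ne hi'.ne]
  rcases hlt with h0 | hlt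
  -- An unset entry means that no run in `S` was feasible, since beating one forces a nonzero
  -- predecessor.
  · exact absurd h0 h₁
  · exact hlt.le.trans h₂

end Table

/-! ### Filling the table -/

section Filling

variable {p : ℝ≥0∞} [Fact (1 ≤ p)] {f : ℝ≥0 → ℝ} {Q : ℕ → ℝ × ℝ} {n J a b : ℕ} {s s' : Store}

/-- The clients are `Q` and the table is filled up to `J < n`, while entry `J + 1` is under
construction and beats the runs in `S`. -/
structure Filling (p : ℝ≥0∞) [Fact (1 ≤ p)] (f : ℝ≥0 → ℝ) (Q : ℕ → ℝ × ℝ) (n J : ℕ)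
    (S : ℕ → ℕ → ℕ → Prop) (s : Store) : Prop where
  nvar_zero : s.nvar 0 = n
  nvar_one : s.nvar 1 = 0
  nvar_two : s.nvar 2 = J
  lt : J < n
  client : s.client = Q
  filled : s.table.Filled p f Q n J
  fresh : ∀ j, J + 1 < j → s.table.pred j = 0
  partial_succ : s.table.Partial p f Q (J + 1)
  beats : s.table.Beats p f Q (J + 1) S

variable {S S' : ℕ → ℕ → ℕ → Prop}

theorem Filling.setNat (h : Filling p f Q n J S s) {v k : ℕ} (hv : 2 < v) :
    Filling p f Q n J S (s.setNat v k) :=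
  { h with
    nvar_zero := (Function.update_of_ne (by omega) ..).trans h.nvar_zero
    nvar_one := (Function.update_of_ne (by omega) ..).trans h.nvar_one
    nvar_two := (Function.update_of_ne (by omega) ..).trans h.nvar_two }

theorem Filling.mono (h : Filling p f Q n J S s)
    (hS : ∀ a b i, S' a b i → i < J + 1 →
      CoversRun p Q (pinCenter p (Q a) (Q b)) (pinRadius p (Q a) (Q b)) i (J + 1) → S a b i) :
    Filling p f Q n J S' s :=
  { h with beats := h.beats.mono hS }

theorem runs_pinProg (s : Store) : Runs p f pinProg s 40 fun s' =>
    s'.rarr = s.rarr ∧ s'.narr = s.narr ∧ s'.nvar = Function.update s.nvar 5 (s.nvar 2 + 1) ∧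
      s'.rvar 0 = pinCenter p (s.client (s.nvar 3)) (s.client (s.nvar 4)) ∧
      s'.rvar 1 = pinRadius p (s.client (s.nvar 3)) (s.client (s.nvar 4)) ∧
      s'.rvar 2 = f (pinRadius p (s.client (s.nvar 3)) (s.client (s.nvar 4))).toNNReal := by
  set c := pinCenter p (s.client (s.nvar 3)) (s.client (s.nvar 4)) with hc
  set d₁ := axisDist p (s.client (s.nvar 3)) c with hd₁
  set d₂ := axisDist p (s.client (s.nvar 4)) c with hd₂
  have hmax : pinRadius p (s.client (s.nvar 3)) (s.client (s.nvar 4)) = max d₁ d₂ := rfl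
  rw [hmax]
  have h₁ : (distExpr (.var 3) (.var 0)).eval p f (s.setReal 0 c) = d₁ := by
    rw [hd₁, axisDist_eq_norm]
    rfl
  have h₂ : (distExpr (.var 4) (.var 0)).eval p f ((s.setReal 0 c).setReal 1 d₁) = d₂ := by
    rw [hd₂, axisDist_eq_norm]
    rfl
  have h : Runs p f (.ite (.rle (.var 1) (.var 2)) (.setR 1 (.var 2)) .skip)
      (((s.setReal 0 c).setReal 1 d₁).setReal 2 d₂) (3 + 2 + 1) fun s' => s'.rarr = s.rarr ∧
        s'.narr = s.narr ∧ s'.nvar = s.nvar ∧ s'.rvar 0 = c ∧ s'.rvar 1 = max d₁ d₂ := by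
    refine Runs.ite (fun hb => Runs.of_eq (.setR rfl) ⟨rfl, rfl, rfl, rfl, ?_⟩) fun hb =>
      (Runs.of_eq .skip ⟨rfl, rfl, rfl, rfl, ?_⟩).mono (by decide) fun _ h => h
    · exact (max_eq_right hb).symm
    · exact (max_eq_left (not_le.1 hb).le).symm
  refine Runs.mono (Runs.seq_eq (.setR rfl) <| .seq_eq (.setR h₁) <| .seq_eq (.setR h₂) <|
    h.seq fun s' h' => .seq_eq (.setR rfl) <| Runs.of_eq (.setN rfl) ?_) (by decide) fun _ h => h
  obtain ⟨hr, ha, hn, h0, h1⟩ := h'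
  refine ⟨hr, ha, ?_, h0, h1, ?_⟩
  · simp [Store.setNat, Store.setReal, NExpr.eval, hn]
  · simp [Store.setNat, Store.setReal, RExpr.eval, h1]

/-- While the run of the circle pinned by `a` and `b` is extended: the clients from `i` to `J` are
covered and the runs starting there have been tried. -/
structure Extending (p : ℝ≥0∞) [Fact (1 ≤ p)] (f : ℝ≥0 → ℝ) (Q : ℕ → ℝ × ℝ) (n J a b : ℕ)
    (S : ℕ → ℕ → ℕ → Prop) (i : ℕ) (s : Store) : Prop where
  filling : Filling p f Q n J (fun a' b' i' => S a' b' i' ∨ (a' = a ∧ b' = b ∧ i ≤ i')) s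
  nvar_three : s.nvar 3 = a
  nvar_four : s.nvar 4 = b
  nvar_five : s.nvar 5 = i
  center : s.rvar 0 = pinCenter p (Q a) (Q b)
  radius : s.rvar 1 = pinRadius p (Q a) (Q b)
  value : s.rvar 2 = f (pinRadius p (Q a) (Q b)).toNNReal
  le : i ≤ J + 1
  covers : CoversRun p Q (pinCenter p (Q a) (Q b)) (pinRadius p (Q a) (Q b)) i (J + 1)

theorem runs_recordProg (s : Store) : Runs p f recordProg s 32 fun s' =>
    s'.nvar = s.nvar ∧ s'.rvar = s.rvar ∧ s'.client = s.client ∧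
      s'.table = s.table.set (s.nvar 2 + 1) (s.table.value (s.nvar 5) + s.rvar 2) (s.rvar 0)
        (s.rvar 1) (s.nvar 5 + 1) := by
  refine Runs.mono (Runs.seq_eq .writeR <| .seq_eq .writeR <| .seq_eq .writeR .writeN)
    (by decide) ?_
  rintro _ rfl
  refine ⟨rfl, rfl, ?_, ?_⟩
  · funext m
    simp [Store.client]
  · simp [Store.table, Table.set, RExpr.eval, NExpr.eval]

theorem runs_relaxProg {i : ℕ} (h : Extending p f Q n J a b S (i + 1) s)
    (hi : axisDist p (Q i) (pinCenter p (Q a) (Q b)) ≤ pinRadius p (Q a) (Q b)) :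
    Runs p f relaxProg s 60 (Extending p f Q n J a b S i) := by
  have hcov : CoversRun p Q (pinCenter p (Q a) (Q b)) (pinRadius p (Q a) (Q b)) i (J + 1) := by
    intro m h₁ h₂
    rcases h₁.eq_or_lt with rfl | h₁
    · exact hi
    · exact h.covers m h₁ h₂
  have hiJ : i < J + 1 := h.le
  have hS : ∀ a' b' i', (S a' b' i' ∨ (a' = a ∧ b' = b ∧ i ≤ i')) →
      (S a' b' i' ∨ (a' = a ∧ b' = b ∧ i + 1 ≤ i')) ∨ (a' = a ∧ b' = b ∧ i' = i) := by
    intro a' b' i'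
    grind
  have hF : Filling p f Q n J (fun a' b' i' => S a' b' i' ∨ (a' = a ∧ b' = b ∧ i + 1 ≤ i'))
    (s.setNat 5 i) := h.filling.setNat (by decide)
  have e5 : (NExpr.sub (.var 5) (.lit 1)).eval s = i := by
    simp only [NExpr.eval, h.nvar_five, Nat.add_sub_cancel]
  have hv2 : (s.setNat 5 i).nvar 2 = J := hF.nvar_two
  have hv5 : (s.setNat 5 i).nvar 5 = i := rfl
  have hr2 : (s.setNat 5 i).rvar 2 = f (pinRadius p (Q a) (Q b)).toNNReal := h.value
  refine Runs.mono (Runs.seq_eq (.setN e5) <| Runs.ite (T := 32) (fun hb => ?_) fun hb => ?_)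
    (by decide) fun _ h => h
  -- The entry is unset or strictly worse than the candidate, which is when overwriting preserves
  -- the earlier comparisons.
  · simp only [Test.Holds, RExpr.eval, NExpr.eval, hv2, hv5, hr2, not_and_or, not_le,
      Nat.lt_one_iff] at hb
    refine (runs_recordProg (p := p) (f := f) (s.setNat 5 i)).mono le_rfl ?_
    rintro s' ⟨hn, hr, hc, ht⟩
    rw [hv2, hv5, hr2, show (s.setNat 5 i).rvar 0 = _ from h.center,
      show (s.setNat 5 i).rvar 1 = _ from h.radius] at ht
    refine ⟨⟨hn ▸ hF.nvar_zero, hn ▸ hF.nvar_one, hn ▸ hv2, hF.lt, hc.trans hF.client, ?_,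
      fun j hj => ?_, ?_, ?_⟩, hn ▸ h.nvar_three, hn ▸ h.nvar_four, hn ▸ hv5, hr ▸ h.center,
      hr ▸ h.radius, hr ▸ h.value, hiJ.le, hcov⟩
    · exact hF.filled.agree (ht ▸ Table.agree_set _ J.lt_succ_self _ _ _ _)
    · rw [ht]
      exact (Function.update_of_ne hj.ne' ..).trans (hF.fresh j hj)
    · rw [ht]
      exact Or.inr (Table.valid_set hiJ hcov)
    · rw [ht]
      exact (hF.beats.set hiJ hb).mono fun a' b' i' h _ _ => hS a' b' i' h
  · simp only [Test.Holds, RExpr.eval, NExpr.eval, hv2, hv5, hr2, not_not] at hb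
    refine (Runs.of_eq .skip ?_).mono (by decide) fun _ h => h
    have hbeats := (hF.beats.insert (Nat.one_le_iff_ne_zero.1 hb.1) hb.2).mono
      fun a' b' i' h _ _ => hS a' b' i' h
    exact ⟨{ hF with beats := hbeats }, h.nvar_three, h.nvar_four, hv5, h.center, h.radius,
      h.value, hiJ.le, hcov⟩

/-- The pair `(a', b')` precedes `(a, b)` in the lexicographic order of the pairs below `n`. -/
def LexLt (n a b a' b' : ℕ) : Prop := (a' < a ∧ b' < n) ∨ (a' = a ∧ b' < b)

theorem runs_runLoop (h : Extending p f Q n J a b S (J + 1) s) :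
    Runs p f runLoop s ((n + 1) * 80) fun s' =>
      Filling p f Q n J (fun a' b' i => S a' b' i ∨ (a' = a ∧ b' = b)) s' ∧
        s'.nvar 3 = a ∧ s'.nvar 4 = b := by
  refine (Runs.while (I := fun i s => Extending p f Q n J a b S i s) (B := 60) (K := 80) (by decide)
    (fun i s h => ?_) (J + 1) s h).mono (Nat.mul_le_mul_right _ (by have := h.filling.lt; omega))
    fun _ h => h
  -- At `i = 0` truncated subtraction reads client `0`; this is harmless, as the other conjunct of
  -- the test fails.
  have hx : (distExpr (.sub (.var 5) (.lit 1)) (.var 0)).eval p f s =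
      axisDist p (Q (i - 1)) (pinCenter p (Q a) (Q b)) := by
    rw [axisDist_eq_norm, ← h.filling.client, ← h.nvar_five, h.filling.client, ← h.center,
      ← h.filling.client]
    rfl
  -- A covered run starting before `i` would contain client `i - 1`, so at the stop every feasible
  -- start has been tried.
  have hdone : (i = 0 ∨
      ¬ axisDist p (Q (i - 1)) (pinCenter p (Q a) (Q b)) ≤ pinRadius p (Q a) (Q b)) →
      Filling p f Q n J (fun a' b' i => S a' b' i ∨ (a' = a ∧ b' = b)) s ∧
        s.nvar 3 = a ∧ s.nvar 4 = b := by
    refine fun h0 => ⟨h.filling.mono fun a' b' i' hS hi' hc => ?_, h.nvar_three, h.nvar_four⟩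
    refine hS.imp id ?_
    rintro ⟨rfl, rfl⟩
    refine ⟨rfl, rfl, ?_⟩
    by_contra! hlt
    rcases h0 with rfl | h0
    · omega
    · exact h0 (hc _ (by omega) (by have := h.le; omega))
  simp only [Test.Holds, hx]
  simp only [NExpr.eval, RExpr.eval, h.nvar_five, h.radius]
  by_cases h1 : 1 ≤ i ∧ axisDist p (Q (i - 1)) (pinCenter p (Q a) (Q b)) ≤ pinRadius p (Q a) (Q b)
  · refine Or.inr ⟨h1, i - 1, by omega, ?_⟩
    rw [← Nat.sub_add_cancel h1.1] at h
    exact runs_relaxProg h h1.2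
  · refine Or.inl ⟨h1, hdone ?_⟩
    rcases Nat.eq_zero_or_pos i with h0 | h0
    · exact Or.inl h0
    · exact Or.inr fun h2 => h1 ⟨h0, h2⟩

theorem runs_pairLoopBody {a b : ℕ} (h : Filling p f Q n J (fun a' b' _ => LexLt n a b a' b') s)
    (h3 : s.nvar 3 = a) (h4 : s.nvar 4 = b) :
    Runs p f (.seq pinProg <| .seq runLoop <| incr 4) s ((n + 1) * 80 + 44) fun s' =>
      Filling p f Q n J (fun a' b' _ => LexLt n a (b + 1) a' b') s' ∧ s'.nvar 3 = a ∧
        s'.nvar 4 = b + 1 := by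
  refine ((runs_pinProg s).seq (T₂ := (n + 1) * 80 + 4) (fun s₁ h₁ => ?_)).mono (by omega)
    fun _ h => h
  obtain ⟨hr, ha, hn, r0, r1, r2⟩ := h₁
  have hc : s₁.client = s.client := by
    funext m
    simp only [Store.client, hr]
  have ht : s₁.table = s.table := by simp only [Store.table, hr, ha]
  rw [h3, h4, h.client] at r0 r1 r2
  have hE : Extending p f Q n J a b (fun a' b' _ => LexLt n a b a' b') (J + 1) s₁ := by
    refine ⟨⟨?_, ?_, ?_, h.lt, hc.trans h.client, ht ▸ h.filled, ht ▸ h.fresh,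
      ht ▸ h.partial_succ, ?_⟩, ?_, ?_, ?_, r0, r1, r2, le_rfl, fun m _ _ => by omega⟩
    · simpa [hn] using h.nvar_zero
    · simpa [hn] using h.nvar_one
    · simpa [hn] using h.nvar_two
    · rw [ht]
      refine h.beats.mono fun a' b' i' hS hi _ => ?_
      rcases hS with hS | ⟨-, -, hi'⟩
      · exact hS
      · omega
    · simpa [hn] using h3
    · simpa [hn] using h4
    · simp [hn, h.nvar_two]
  refine (runs_runLoop hE).seq fun s₂ h₂ => Runs.of_eq (.incr h₂.2.2) ⟨?_, h₂.2.1, rfl⟩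
  refine (h₂.1.setNat (by decide)).mono fun a' b' i' hS _ _ => ?_
  unfold LexLt at *
  omega

theorem runs_rowLoopBody {a : ℕ} (h : Filling p f Q n J (fun a' b' _ => a' < a ∧ b' < n) s)
    (h3 : s.nvar 3 = a) :
    Runs p f (.seq (.setN 4 (.lit 0)) <|
      .seq (forLoop 4 <| .seq pinProg <| .seq runLoop <| incr 4) <| incr 3) s
      ((n + 1) * ((n + 1) * 130) + 6) fun s' =>
      Filling p f Q n J (fun a' b' _ => a' < a + 1 ∧ b' < n) s' ∧ s'.nvar 3 = a + 1 := by
  have hloop := Runs.forLoop (p := p) (f := f) (v := 4) (n := n) (B := (n + 1) * 80 + 44)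
    (K := (n + 1) * 130) (c := .seq pinProg <| .seq runLoop <| incr 4)
    (I := fun b s => Filling p f Q n J (fun a' b' _ => LexLt n a b a' b') s ∧ s.nvar 3 = a ∧
      s.nvar 4 = b ∧ b ≤ n) (s := s.setNat 4 0) (k := 0) (by omega)
    (fun b s h => ⟨h.2.2.1, h.1.nvar_zero, h.2.2.2⟩)
    (fun b s hb h => (runs_pairLoopBody h.1 h.2.1 h.2.2.1).mono le_rfl
      fun s' h' => ⟨h'.1, h'.2.1, h'.2.2, hb⟩)
    ⟨(h.setNat (by decide)).mono fun a' b' _ hS _ _ => ?_, h3, rfl, Nat.zero_le _⟩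
  · refine (Runs.seq_eq (.setN rfl) (hloop.seq fun s' h' => Runs.of_eq (.incr h'.2.1)
      (⟨(h'.1.setNat (by decide)).mono fun a' b' _ hS _ _ => ?_, rfl⟩ :
        _ ∧ (s'.setNat 3 (a + 1)).nvar 3 = a + 1))).mono ?_ fun _ h => h
    · unfold LexLt
      omega
    · simp only [NExpr.steps]
      omega
  · unfold LexLt at hS
    omega

/-- The table is filled up to `J`, and the later entries are unset. -/
structure FilledUpTo (p : ℝ≥0∞) [Fact (1 ≤ p)] (f : ℝ≥0 → ℝ) (Q : ℕ → ℝ × ℝ) (n J : ℕ)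
    (s : Store) : Prop where
  nvar_zero : s.nvar 0 = n
  nvar_one : s.nvar 1 = 0
  nvar_two : s.nvar 2 = J
  le : J ≤ n
  client : s.client = Q
  filled : s.table.Filled p f Q n J
  fresh : ∀ j, J < j → s.table.pred j = 0

theorem FilledUpTo.filling (h : FilledUpTo p f Q n J s) (hJ : J < n) :
    Filling p f Q n J (fun _ _ _ => False) s :=
  { h with
    lt := hJ
    fresh := fun j hj => h.fresh j (by omega)
    partial_succ := Or.inl (h.fresh _ J.lt_succ_self)
    beats := fun _ _ _ h => h.elim }

theorem Filling.filledUpTo (h : Filling p f Q n J (fun a b _ => a < n ∧ b < n) s) :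
    FilledUpTo p f Q n (J + 1) (s.setNat 2 (J + 1)) := by
  refine ⟨h.nvar_zero, h.nvar_one, rfl, h.lt, h.client, ⟨h.filled.1, fun j hj hjJ => ?_⟩, h.fresh⟩
  rcases hjJ.lt_or_eq with hjJ | rfl
  · exact h.filled.2 j hj (Nat.lt_succ_iff.1 hjJ)
  · refine ⟨h.partial_succ.resolve_left ?_, h.beats⟩
    -- The entry is set: the circle pinned by client `J` and itself covers the run consisting of `J`
    -- alone.
    refine (h.beats J J J ⟨h.lt, h.lt⟩ J.lt_succ_self fun m h₁ h₂ => ?_).1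
    obtain rfl : m = J := by omega
    exact le_max_left _ _

theorem runs_tableProg (h : FilledUpTo p f Q n 0 (s.setNat 2 0)) :
    Runs p f tableProg s ((n + 1) * ((n + 1) * ((n + 1) * ((n + 1) * 170))) + 2)
      (FilledUpTo p f Q n n) := by
  refine (Runs.seq_eq (.setN rfl) (Runs.forLoop (I := FilledUpTo p f Q n)
    (B := (n + 1) * ((n + 1) * ((n + 1) * 150)) + 6)
    (K := (n + 1) * ((n + 1) * ((n + 1) * 170))) (by nlinarith [sq_nonneg n])
    (fun J s h => ⟨h.nvar_two, h.nvar_zero, h.le⟩) (fun J s hJ h => ?_) h)).mono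
    (by simp only [NExpr.steps]; omega) fun _ h => h
  have hloop := Runs.forLoop (p := p) (f := f) (v := 3) (n := n)
    (B := (n + 1) * ((n + 1) * 130) + 6) (K := (n + 1) * ((n + 1) * 150))
    (c := .seq (.setN 4 (.lit 0)) <|
      .seq (forLoop 4 <| .seq pinProg <| .seq runLoop <| incr 4) <| incr 3)
    (I := fun a s => Filling p f Q n J (fun a' b' _ => a' < a ∧ b' < n) s ∧ s.nvar 3 = a ∧ a ≤ n)
    (s := s.setNat 3 0) (k := 0) (by nlinarith)
    (fun a s h => ⟨h.2.1, h.1.nvar_zero, h.2.2⟩)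
    (fun a s ha h => (runs_rowLoopBody h.1 h.2.1).mono le_rfl fun s' h' => ⟨h'.1, h'.2, ha⟩)
    ⟨((h.filling hJ).setNat (by decide)).mono fun a' b' _ hS _ _ => absurd hS.1 (Nat.not_lt_zero _),
      rfl, Nat.zero_le _⟩
  exact (Runs.seq_eq (.setN rfl) (hloop.seq fun s' h' =>
    Runs.of_eq (.incr h'.1.nvar_two) h'.1.filledUpTo)).mono
    (by simp only [NExpr.steps]; omega) fun _ h => h

end Filling

/-! ### Output and optimality -/

section Optimality

variable {p : ℝ≥0∞} [Fact (1 ≤ p)] {f : ℝ≥0 → ℝ} {Q : ℕ → ℝ × ℝ} {n : ℕ} {s : Store}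

/-- By induction on the runs: each circle is at least as large as the circle pinned by two clients
of its run, whose cost the table has taken into account. -/
theorem Table.Filled.value_le {τ : Table} (hf : Monotone f) (h : τ.Filled p f Q n n) {k : ℕ}
    {L : List AxisCircle} (hL : RunCover p Q k L) (hk : k ≤ n) : τ.value k ≤ cost f L := by
  induction hL with
  | nil => exact h.1.le
  | @cons i j C L hL hij hC ih =>
    obtain ⟨a, ha, b, hb, hr, hcov⟩ := exists_pinned_circle (Finset.Ico i j)
      (Finset.nonempty_Ico.2 hij) Q fun m hm => hC m (Finset.mem_Ico.1 hm).1 (Finset.mem_Ico.1 hm).2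
    rw [Finset.mem_Ico] at ha hb
    have h₁ := ((h.2 j (by omega) hk).2 a b i ⟨by omega, by omega⟩ hij
      fun m h₁ h₂ => hcov m (Finset.mem_Ico.2 ⟨h₁, h₂⟩)).2
    have h₂ : f (pinRadius p (Q a) (Q b)).toNNReal ≤ f C.radius :=
      hf (Real.toNNReal_le_iff_le_coe.2 hr)
    rw [cost_cons]
    linarith [ih (by omega)]

theorem outputs_append {L : List AxisCircle} {C : AxisCircle} {s' : Store} (h : Outputs s L)
    (h1 : s'.nvar 1 = L.length + 1)
    (h2 : s'.rarr 2 = Function.update (s.rarr 2) L.length C.center)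
    (h3 : s'.rarr 3 = Function.update (s.rarr 3) L.length C.radius) : Outputs s' (L ++ [C]) := by
  refine ⟨by simpa using h1, fun i hi => ?_⟩
  rw [h2, h3]
  rw [List.length_append, List.length_singleton] at hi
  rcases (Nat.lt_succ_iff.1 hi).eq_or_lt with rfl | hi
  · simp
  · simpa [List.getElem_append_left hi, hi.ne] using h.2 i hi

/-- The circles output so far cover the clients from `k` on. -/
structure Reading (p : ℝ≥0∞) [Fact (1 ≤ p)] (f : ℝ≥0 → ℝ) (Q : ℕ → ℝ × ℝ) (n : ℕ) (τ : Table)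
    (k : ℕ) (s : Store) : Prop where
  nvar_two : s.nvar 2 = k
  le : k ≤ n
  table : s.table = τ
  exists_list : ∃ L, Outputs s L ∧ cost f L + τ.value k = τ.value n ∧
    ∀ m, k ≤ m → m < n → ∃ C ∈ L, C.Covers p (Q m)

/-- Following the predecessors telescopes the values: the cost output so far plus the value at `k`
stays equal to the value at `n`. Each predecessor is smaller, so the walk ends at `0`. -/
theorem runs_outputProg {τ : Table} (hτ : τ.Filled p f Q n n) (h : Reading p f Q n τ n s) :
    Runs p f outputProg s ((n + 1) * 30) (Reading p f Q n τ 0) := by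
  refine Runs.while (I := Reading p f Q n τ) (B := 20) (by decide) (fun k s h => ?_) n s h
  simp only [Test.Holds, NExpr.eval, h.nvar_two]
  rcases Nat.eq_zero_or_pos k with rfl | hk
  · exact Or.inl ⟨by omega, h⟩
  obtain ⟨⟨i, hik, hp, hr, hv, hc⟩, -⟩ := hτ.2 k hk h.le
  obtain ⟨L, hO, hcost, hcov⟩ := h.exists_list
  refine Or.inr ⟨hk, i, hik, ?_⟩
  refine (Runs.seq_eq .writeR <| .seq_eq .writeR <| .seq_eq (.setN rfl) (.setN rfl)).mono
    (by decide) ?_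
  rintro _ rfl
  have e4 : τ.value = s.rarr 4 := by rw [← h.table]; rfl
  have e5 : τ.center = s.rarr 5 := by rw [← h.table]; rfl
  have e6 : τ.radius = s.rarr 6 := by rw [← h.table]; rfl
  have e0 : τ.pred = s.narr 0 := by rw [← h.table]; rfl
  refine ⟨?_, by have := h.le; omega, ?_, L ++ [⟨τ.center k, (τ.radius k).toNNReal⟩],
    outputs_append hO ?_ ?_ ?_, ?_, fun m h₁ h₂ => ?_⟩
  · simp [Store.setNat, NExpr.eval, h.nvar_two, ← e0, hp]
  · rw [← h.table]
    simp [Store.setNat, Store.table]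
  · simp [Store.setNat, NExpr.eval, hO.1]
  · simp [Store.setNat, NExpr.eval, RExpr.eval, hO.1, h.nvar_two, e5]
  · simp [Store.setNat, NExpr.eval, RExpr.eval, hO.1, h.nvar_two, ← e6, hr]
  · have : cost f (L ++ [⟨τ.center k, (τ.radius k).toNNReal⟩]) =
        cost f L + f (τ.radius k).toNNReal := by simp [cost]
    linarith
  · rcases lt_or_ge m k with hm | hm
    · refine ⟨_, List.mem_append_right _ (List.mem_singleton_self _), ?_⟩
      rw [AxisCircle.Covers, Real.coe_toNNReal _ hr]
      exact hc m h₁ hm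
    · obtain ⟨C, hC, hCm⟩ := hcov m hm h₂
      exact ⟨C, List.mem_append_left _ hC, hCm⟩

/-- Being a cover depends only on the set of clients, so sorting does not change the problem. -/
theorem isCover_iff_of_image_eq {Y : Fin n → ℝ × ℝ} (h : Q '' Set.Iio n = Set.range Y)
    (L : List AxisCircle) : IsCover p Y L ↔ ∀ i < n, ∃ C ∈ L, C.Covers p (Q i) := by
  have h₁ : IsCover p Y L ↔ ∀ q ∈ Set.range Y, ∃ C ∈ L, C.Covers p q := by
    simp [IsCover]
  rw [h₁, ← h]
  simp

theorem prepared_inputStore (Y : Fin n → ℝ × ℝ) :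
    Prepared n (Set.range Y) (inputStore Y) := by
  refine ⟨rfl, rfl, fun _ => rfl, ?_, ?_⟩
  · simp [inputStore]
  · have h : ∀ i : Fin n, (inputStore Y).client i = Y i := fun i => by
      simp [Store.client, inputStore]
    ext q
    constructor
    · rintro ⟨i, hi, rfl⟩
      exact ⟨⟨i, hi⟩, (h ⟨i, hi⟩).symm⟩
    · rintro ⟨i, rfl⟩
      exact ⟨i, i.2, h i⟩

theorem runs_coverProg (hf : Monotone f) (hf0 : 0 ≤ f 0) (Y : Fin n → ℝ × ℝ) :
    Runs p f coverProg (inputStore Y) ((n + 1) ^ 4 * 400)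
      fun s => ∃ L, Outputs s L ∧ IsMinCostCover p f Y L := by
  refine ((runs_sortProg (prepared_inputStore Y) rfl).seq fun s₁ h₁ => ?_).mono
    (T₁ := (n + 1) * ((n + 1) * 120) +
      ((n + 1) * ((n + 1) * ((n + 1) * ((n + 1) * 170))) + 2 + (n + 1) * 30)) ?_ fun _ h => h
  · obtain ⟨hprep, hsort⟩ := h₁
    have hstart : FilledUpTo p f s₁.client n 0 (s₁.setNat 2 0) :=
      ⟨hprep.nvar_zero, hprep.nvar_one, rfl, Nat.zero_le _, rfl,
        ⟨hprep.rarr_four, fun j h₁ h₂ => by omega⟩, fun j _ => hprep.narr_zero j⟩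
    refine (runs_tableProg hstart).seq fun s₂ h₂ => ?_
    refine (runs_outputProg h₂.filled ⟨h₂.nvar_two, le_rfl, rfl, [], ⟨h₂.nvar_one, by simp⟩,
      by simp [cost], fun m h₁ h₂ => by omega⟩).mono le_rfl fun s₃ h₃ => ?_
    obtain ⟨L, hO, hcost, hcov⟩ := h₃.exists_list
    rw [h₂.filled.1, add_zero] at hcost
    refine ⟨L, hO, (isCover_iff_of_image_eq hprep.clients L).2 fun i hi =>
      hcov i (Nat.zero_le _) hi, fun L' hL' => ?_⟩
    obtain ⟨L'', hrun, hle⟩ := exists_runCover (fun r => hf0.trans (hf zero_le)) _ n L' rfl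
      hsort ((isCover_iff_of_image_eq hprep.clients L').1 hL')
    -- The output costs exactly the value at `n`, which is at most the cost of the run partition
    -- `L''` and hence of the arbitrary cover `L'`.
    exact hcost ▸ (h₂.filled.value_le hf hrun le_rfl).trans hle
  -- Every term is at most its coefficient times `N ^ 4`, and `120 + 170 + 2 + 30 ≤ 400`.
  · have h : 1 ≤ n + 1 := by omega
    generalize n + 1 = N at h
    have h₂ : N ^ 2 ≤ N ^ 4 := Nat.pow_le_pow_right h (by decide)
    have h₁ : N ^ 1 ≤ N ^ 4 := Nat.pow_le_pow_right h (by decide)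
    have h₀ : N ^ 0 ≤ N ^ 4 := Nat.pow_le_pow_right h (by decide)
    ring_nf at *
    omega

end Optimality

/-! ### The asymptotic time bound. -/

theorem isBigO_time : (fun n : ℕ => (((n + 1) ^ 4 * 400 : ℕ) : ℝ)) =O[Filter.atTop]
    (fun n : ℕ => (n : ℝ) ^ 4 * Real.log (n : ℝ)) := by
  -- `6400 = 400 * 2 ^ 4` from `n + 1 ≤ 2 * n`; from `n = 3 > e` on, the logarithm is at least `1`.
  refine Asymptotics.IsBigO.of_bound 6400 ?_
  filter_upwards [Filter.eventually_ge_atTop 3] with n hn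
  have hn' : (3 : ℝ) ≤ n := by exact_mod_cast hn
  have hlog : 1 ≤ Real.log n := by
    rw [Real.le_log_iff_exp_le (by linarith)]
    linarith [Real.exp_one_lt_d9]
  have h4 : ((n : ℝ) + 1) ^ 4 ≤ (2 * n) ^ 4 := by gcongr; linarith
  have h5 : (n : ℝ) ^ 4 ≤ (n : ℝ) ^ 4 * Real.log n := le_mul_of_one_le_right (by positivity) hlog
  rw [Real.norm_of_nonneg (by positivity), Real.norm_of_nonneg (by positivity)]
  push_cast
  rw [mul_pow] at h4
  linarith

end LineCover

theorem mainTheorem5 (p : ℝ≥0∞) [Fact (1 ≤ p)] :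
    ∃ (prog : LineCover.Prog) (T : ℕ → ℕ),
      (fun n : ℕ => (T n : ℝ)) =O[Filter.atTop] (fun n : ℕ => (n : ℝ) ^ 4 * Real.log (n : ℝ)) ∧
      ∀ f : ℝ≥0 → ℝ, Monotone f → 0 ≤ f 0 →
        ∀ (n : ℕ) (Y : Fin n → ℝ × ℝ),
          ∃ (t : ℕ) (s : LineCover.Store) (L : List LineCover.AxisCircle),
            LineCover.Exec p f prog (LineCover.inputStore Y) t s ∧ t ≤ T n ∧
            LineCover.Outputs s L ∧ LineCover.IsMinCostCover p f Y L := by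
  refine ⟨LineCover.coverProg, _, LineCover.isBigO_time, fun f hf hf0 n Y => ?_⟩
  obtain ⟨t, s, he, ht, L, hO, hmin⟩ := LineCover.runs_coverProg (p := p) hf hf0 Y
  exact ⟨t, s, L, he, ht, hO, hmin⟩
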